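/- Let $\Gamma$ be a finite connected distance-regular graph of diameter $D\ge 3$ with intersection numbers $b_i,c_i$ $(0\le i\le D)$; put $k=b_0$ and $a_1=k-b_1-c_1$. Suppose $\Gamma$ has classical parameters $(D,b,\alpha,\beta)$ with $b,\alpha,\beta$ real and $b\ge 2$, i.e. with $[j]=1+b+\cdots+b^{j-1}$, $$b_i=([D]-[i])(\beta-\alpha[i])\ (0\le i\le D-1),\qquad c_i=[i](1+\alpha[i-1])\ (1\le i\le D).$$ Let $r=[D]$, and let $s$ be a positive integer such that $\Gamma$ has the SPLS$(s)$ property, i.e. such that $s\ge 2$, $a_1\ge(2s-1)(c_2-1)$ and, with $\mathcal L$ the set of maximal cliques of $\Gamma$ having at least $a_1+2-(c_2-1)(s-1)$ vertices (called lines), the following hold: $\mathcal L$ is non-empty and any two distinct vertices lie on at most one common line; two distinct vertices are adjacent if and only if they lie on a common line; each vertex lies on at most $s$ lines; and for every line $\ell$ and every vertex $x\notin\ell$, at most $c_2$ vertices of $\ell$ lie on a common line with $x$. A Delsarte clique is a clique with exactly $1+\frac{k}{-\theta_{\min}}$ vertices, where $\theta_{\min}$ is the smallest eigenvalue of the adjacency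 matrix of $\Gamma$. A vertex is called a Delsarte vertex if all lines through it are Delsarte cliques. For vertices $x,y$ at distance $2$, let $[x,y]$ be the set of lines $\ell$ through $x$ such that $d(y,u)\le 2$ for all $u\in\ell$. Then the following hold: 1. $s\ge r$; 2. more than $\frac{c_2-2}{c_2-1}|V(\Gamma)|$ vertices of $\Gamma$ are Delsarte vertices; 3. $\alpha$ is an integer with $0\le\alpha\le b$, and $\beta$ is a positive integer; 4. there exist vertices $x,y$ at distance $2$ with $|[x,y]|\ge b+1$. -/

import Mathlib

namespace ClassicalDRG

/-! ### Distance-regular graphs and classical parameters -/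

/-- `G` is a distance-regular graph of diameter `D` with intersection numbers `bi i` and `ci i`
(`0 ≤ i ≤ D`): for all vertices `x`, `y` at distance `i`, exactly `ci i` neighbours of `y` are at
distance `i - 1` from `x` and exactly `bi i` neighbours of `y` are at distance `i + 1` from `x`.
(These conditions force `ci 0 = 0` and `bi D = 0`; values at `i > D` play no role.) -/
structure IsDistanceRegular {V : Type*} (G : SimpleGraph V) (D : ℕ) (bi ci : ℕ → ℕ) : Prop where
  connected : G.Connected
  diam_eq : G.diam = D
  card_c : ∀ x y : V, {z | G.Adj y z ∧ G.dist x z + 1 = G.dist x y}.ncard = ci (G.dist x y)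
  card_b : ∀ x y : V, {z | G.Adj y z ∧ G.dist x z = G.dist x y + 1}.ncard = bi (G.dist x y)

/-- The intersection number `a_i = k - b_i - c_i`, where `k = b_0` is the valency. -/
def aNum (bi ci : ℕ → ℕ) (i : ℕ) : ℤ := (bi 0 : ℤ) - bi i - ci i

/-- `[j] = 1 + b + ⋯ + b ^ (j - 1)`, which is `(b ^ j - 1) / (b - 1)` if `b ≠ 1`
and `j` if `b = 1`. -/
noncomputable def gaussNum (b : ℝ) (j : ℕ) : ℝ := ∑ i ∈ Finset.range j, b ^ i

/-- `G` is a distance-regular graph with intersection numbers `bi`, `ci` that has classical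
parameters `(D, b, α, β)`. -/
structure HasClassicalParameters {V : Type*} (G : SimpleGraph V) (bi ci : ℕ → ℕ)
    (D : ℕ) (b α β : ℝ) : Prop where
  distanceRegular : IsDistanceRegular G D bi ci
  b_eq : ∀ i : ℕ, i < D →
    (bi i : ℝ) = (gaussNum b D - gaussNum b i) * (β - α * gaussNum b i)
  c_eq : ∀ i : ℕ, 1 ≤ i → i ≤ D →
    (ci i : ℝ) = gaussNum b i * (1 + α * gaussNum b (i - 1))

/-! ### Delsarte cliques -/

open Classical in
/-- The smallest eigenvalue `θ_min` of (the adjacency matrix of) a finite graph. -/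
noncomputable def minEigenvalue {V : Type*} [Fintype V] (G : SimpleGraph V) : ℝ :=
  sInf {θ : ℝ | Module.End.HasEigenvalue (Matrix.toLin' (G.adjMatrix ℝ)) θ}

/-- A Delsarte clique of a graph with valency `k`: a clique with `1 + k / (-θ_min)` vertices. -/
def IsDelsarteClique {V : Type*} [Fintype V] (G : SimpleGraph V) (k : ℕ) (C : Set V) : Prop :=
  G.IsClique C ∧ (C.ncard : ℝ) = 1 + (k : ℝ) / (-minEigenvalue G)

/-! ### Partial linear spaces whose lines are sets of points -/

/-- `(V, L, ∈)` is a partial linear space: points and lines exist, and two distinct points are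
on at most one common line. -/
structure IsPartialLinearSpace {V : Type*} (L : Set (Set V)) : Prop where
  points_nonempty : Nonempty V
  lines_nonempty : L.Nonempty
  line_unique : ∀ p q : V, p ≠ q → ∀ l ∈ L, ∀ m ∈ L, p ∈ l → q ∈ l → p ∈ m → q ∈ m → l = m

/-- `G` is the point graph of `(V, L, ∈)`. -/
def IsPointGraph {V : Type*} (G : SimpleGraph V) (L : Set (Set V)) : Prop :=
  ∀ x y : V, G.Adj x y ↔ x ≠ y ∧ ∃ l ∈ L, x ∈ l ∧ y ∈ l

/-- `τ(x, l)`: the number of points on the line `l` that are collinear with `x`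
(used for `x ∉ l`). -/
noncomputable def tau {V : Type*} (L : Set (Set V)) (x : V) (l : Set V) : ℕ :=
  {p | p ∈ l ∧ ∃ m ∈ L, x ∈ m ∧ p ∈ m}.ncard

/-- `τ(X)`: the maximum of `τ(x, l)` over all non-incident point-line pairs
(a maximum over a finite set when `V` is finite). -/
noncomputable def tauMax {V : Type*} (L : Set (Set V)) : ℕ :=
  sSup {n : ℕ | ∃ x : V, ∃ l ∈ L, x ∉ l ∧ n = tau L x l}

/-- `[x, y]`: the set of lines `l` through `x` all of whose points are at distance at most `2`
from `y`. -/
def lineInterval {V : Type*} (G : SimpleGraph V) (L : Set (Set V)) (x y : V) : Set (Set V) :=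
  {l | l ∈ L ∧ x ∈ l ∧ ∀ u ∈ l, G.dist y u ≤ 2}

/-- A Delsarte vertex: all lines through `x` are Delsarte cliques (`k` is the valency). -/
def IsDelsarteVertex {V : Type*} [Fintype V] (G : SimpleGraph V) (k : ℕ) (L : Set (Set V))
    (x : V) : Prop :=
  ∀ l ∈ L, x ∈ l → IsDelsarteClique G k l

/-! ### The SPLS property -/

/-- The lines of the SPLS`(c, s)` property: the maximal cliques with at least
`a_1 + 2 - (c - 1)(s - 1)` vertices. -/
def splsLines {V : Type*} (G : SimpleGraph V) (bi ci : ℕ → ℕ) (c s : ℕ) : Set (Set V) :=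
  {l | Maximal (fun C : Set V => G.IsClique C) l ∧
    aNum bi ci 1 + 2 - ((c : ℤ) - 1) * ((s : ℤ) - 1) ≤ (l.ncard : ℤ)}

/-- The SPLS`(c, s)` property of a distance-regular graph with intersection numbers
`bi`, `ci`. -/
structure HasSPLS₂ {V : Type*} (G : SimpleGraph V) (bi ci : ℕ → ℕ) (c s : ℕ) : Prop where
  one_le_c : 1 ≤ c
  two_le_s : 2 ≤ s
  partialLinearSpace : IsPartialLinearSpace (splsLines G bi ci c s)
  pointGraph : IsPointGraph G (splsLines G bi ci c s)
  a_one_ge : (2 * (s : ℤ) - 1) * ((c : ℤ) - 1) ≤ aNum bi ci 1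
  lines_le : ∀ x : V, {l | l ∈ splsLines G bi ci c s ∧ x ∈ l}.ncard ≤ s
  tauMax_le : tauMax (splsLines G bi ci c s) ≤ c

/-- The SPLS`(s)` property is SPLS`(c_2, s)`. -/
def HasSPLS {V : Type*} (G : SimpleGraph V) (bi ci : ℕ → ℕ) (s : ℕ) : Prop :=
  HasSPLS₂ G bi ci (ci 2) s

end ClassicalDRG

/-! A Delsarte-bound argument combined with a rank count. Write r = [D]. The alternating standard
sequence of classical parameters gives the eigenvalue -r, and `neg_le_of_eigenvector` shows that no
eigenvalue is smaller; hence A + rI is positive semidefinite, and every clique has at most 1 + β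
vertices.

The k = rβ neighbours of a vertex are partitioned by its lines, each containing at most β of them.
So every vertex lies on at least r lines, with equality only if all its lines have 1 + β points,
i.e. are Delsarte cliques. Let S be the set of vertices on exactly r lines. If N is the incidence
matrix and Δ the diagonal matrix of line counts, then N Nᵀ = (A + rI) + (Δ - rI) is a sum of two
positive semidefinite matrices. A vector with zero sum on all lines is therefore supported on S,
whence |V| ≤ |L| + |S| (`card_le_card_lines_add`).

By the SPLS inequalities lines are long, and double counting flags gives |L|(c₂ - 1) < |V|. Thus S
has more than (c₂ - 2)/(c₂ - 1) of the vertices. As c₂ ≥ 3 this exceeds one half, so S contains two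
vertices x, y at distance 2 (`exists_mem_mem_dist_eq`).

The rest is local at x, y. An outside vertex with a neighbour in a Delsarte clique has exactly 1 + α
neighbours there (`card_filter_adj_of_card_eq`), so α and β are integers with α ≥ 0. Since c₂ = (1 +
b)(1 + α), exactly b + 1 lines through x contain neighbours of y. Counting the lines that join y to
points of one such line yields α ≤ b. -/

namespace ClassicalDRG

open scoped Classical Matrix

/-! ### The algebra of functions of the distance -/

/-- The matrix `(x, y) ↦ f (dist x y)`. -/
noncomputable def distMatrix {V : Type*} (G : SimpleGraph V) (f : ℕ → ℝ) : Matrix V V ℝ :=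
  Matrix.of fun x y => f (G.dist x y)

/-- The operator on functions of the distance which corresponds to multiplication of
`distMatrix` by the adjacency matrix. -/
def tridiag (bi ci : ℕ → ℕ) (f : ℕ → ℝ) (j : ℕ) : ℝ :=
  ci j * f (j - 1) + ((bi 0 : ℝ) - bi j - ci j) * f j + bi j * f (j + 1)

theorem ncard_setOf_eq_card_filter {V : Type*} [Fintype V] (P : V → Prop) :
    {x | P x}.ncard = (Finset.univ.filter P).card := by
  rw [← Set.ncard_coe_finset]
  simp

/-! ### Distance-regular graphs: eigenfunctions of the distance, clique bound, smallest eigenvalue.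
-/

section DistanceRegular

variable {V : Type*} {G : SimpleGraph V} {bi ci : ℕ → ℕ} {D : ℕ}

theorem distMatrix_transpose (f : ℕ → ℝ) : (distMatrix G f)ᵀ = distMatrix G f := by
  ext x y
  simp [distMatrix, SimpleGraph.dist_comm]

theorem IsDistanceRegular.exists_dist_eq (h : IsDistanceRegular G D bi ci) {i : ℕ}
    (hi : i ≤ D) : ∃ x y : V, G.dist x y = i ∧
      (i < D → ∃ z, G.Adj y z ∧ G.dist x z = i + 1) := by
  have := h.connected.nonempty
  obtain ⟨x, y, hxy⟩ := G.exists_dist_eq_diam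
  rw [h.diam_eq] at hxy
  obtain ⟨p, hp⟩ := h.connected.exists_walk_length_eq_dist x y
  -- The two pieces of a geodesic of length D have lengths j and D - j, so the triangle inequality
  -- forces equality in both bounds.
  have key : ∀ j ≤ D, G.dist x (p.getVert j) = j := by
    intro j hj
    have h1 : G.dist x (p.getVert j) ≤ j :=
      (SimpleGraph.dist_le (p.take j)).trans (by simp [SimpleGraph.Walk.take_length])
    have h2 : G.dist (p.getVert j) y ≤ D - j :=
      (SimpleGraph.dist_le (p.drop j)).trans (by simp [SimpleGraph.Walk.drop_length, hp, hxy])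
    have := h.connected.dist_triangle (u := x) (v := p.getVert j) (w := y)
    omega
  refine ⟨x, p.getVert i, key i hi, fun hlt => ⟨p.getVert (i + 1), ?_, key _ hlt⟩⟩
  exact p.adj_getVert_succ (by omega)

theorem IsDistanceRegular.ci_zero (h : IsDistanceRegular G D bi ci) : ci 0 = 0 := by
  obtain ⟨x⟩ := h.connected.nonempty
  have := h.card_c x x
  rw [SimpleGraph.dist_self] at this
  simpa using this.symm

theorem sum_sum_clique {C : Finset V} (hC : G.IsClique (C : Set V)) {u : ℕ → ℝ}
    (hu0 : u 0 = 1) :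
    ∑ x ∈ C, ∑ y ∈ C, u (G.dist x y) = C.card * (1 + ((C.card : ℝ) - 1) * u 1) := by
  have : ∀ x ∈ C, ∑ y ∈ C, u (G.dist x y) = 1 + ((C.card : ℝ) - 1) * u 1 := by
    intro x hx
    rw [← Finset.add_sum_erase _ _ hx, SimpleGraph.dist_self, hu0]
    have : ∀ y ∈ C.erase x, u (G.dist x y) = u 1 := by
      intro y hy
      rw [Finset.mem_erase] at hy
      rw [SimpleGraph.dist_eq_one_iff_adj.2 (hC hx hy.2 hy.1.symm)]
    rw [Finset.sum_congr rfl this, Finset.sum_const, Finset.card_erase_of_mem hx, nsmul_eq_mul,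
      Nat.cast_sub (Finset.card_pos.2 ⟨x, hx⟩)]
    simp
  rw [Finset.sum_congr rfl this, Finset.sum_const, nsmul_eq_mul]

variable [Fintype V]

theorem IsDistanceRegular.dist_le (h : IsDistanceRegular G D bi ci) (x y : V) :
    G.dist x y ≤ D := by
  have := h.connected.nonempty
  rw [← h.diam_eq]
  exact SimpleGraph.dist_le_diam (SimpleGraph.connected_iff_ediam_ne_top.1 h.connected)

theorem IsDistanceRegular.bi_pos (h : IsDistanceRegular G D bi ci) {i : ℕ} (hi : i < D) :
    0 < bi i := by
  obtain ⟨x, y, hxy, hz⟩ := h.exists_dist_eq hi.le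
  obtain ⟨z, hz, hz'⟩ := hz hi
  rw [← hxy, ← h.card_b x y, Set.ncard_pos]
  exact ⟨z, hz, by rw [hz', hxy]⟩

theorem IsDistanceRegular.ci_pos (h : IsDistanceRegular G D bi ci) {i : ℕ} (hi0 : 0 < i)
    (hi : i ≤ D) : 0 < ci i := by
  obtain ⟨j, rfl⟩ := Nat.exists_eq_add_of_lt hi0
  obtain ⟨x, y, hxy, hz⟩ := h.exists_dist_eq (i := j) (by omega)
  obtain ⟨z, hz, hz'⟩ := hz (by omega)
  have := h.card_c x z
  rw [hz'] at this
  rw [show 0 + j + 1 = j + 1 by omega, ← this, Set.ncard_pos]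
  exact ⟨y, hz.symm, by rw [hxy]⟩

theorem IsDistanceRegular.bi_diam (h : IsDistanceRegular G D bi ci) : bi D = 0 := by
  obtain ⟨x, y, hxy, -⟩ := h.exists_dist_eq le_rfl
  rw [← hxy, ← h.card_b x y, Set.ncard_eq_zero]
  ext z
  have := h.dist_le x z
  simp only [Set.mem_ofPred_eq, Set.mem_empty_iff_false, iff_false, not_and]
  omega

theorem IsDistanceRegular.card_neighborFinset (h : IsDistanceRegular G D bi ci) (x : V) :
    (G.neighborFinset x).card = bi 0 := by
  have := h.card_b x x
  rw [SimpleGraph.dist_self, ncard_setOf_eq_card_filter] at this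
  rw [← this]
  congr 1
  ext z
  simp +contextual [SimpleGraph.dist_eq_one_iff_adj]

theorem IsDistanceRegular.sum_neighborFinset (h : IsDistanceRegular G D bi ci) (f : ℕ → ℝ)
    (x y : V) :
    ∑ z ∈ G.neighborFinset y, f (G.dist x z) = tridiag bi ci f (G.dist x y) := by
  set j := G.dist x y with hj
  have hpt : ∀ z ∈ G.neighborFinset y, f (G.dist x z) = f j +
      (if G.dist x z + 1 = j then f (j - 1) - f j else 0) +
      (if G.dist x z = j + 1 then f (j + 1) - f j else 0) := by
    intro z hz
    rw [SimpleGraph.mem_neighborFinset] at hz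
    rcases hz.diff_dist_adj (u := x) with hd | hd | hd
    · rw [← hj] at hd
      simp [hd]
    · rw [← hj] at hd
      simp [hd, show j + 1 + 1 ≠ j by omega]
    · rw [← hj] at hd
      -- For j = 0 the truncated j - 1 is again 0: neither indicator fires, and the term f j is
      -- already right.
      rcases Nat.eq_zero_or_pos j with h0 | h0
      · simp [hd, h0]
      · simp [hd, show j - 1 + 1 = j by omega, show j - 1 ≠ j + 1 by omega]
  have hc : ((G.neighborFinset y).filter fun z => G.dist x z + 1 = j).card = ci j := by
    rw [hj, ← h.card_c x y, ncard_setOf_eq_card_filter]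
    congr 1
    ext z
    simp
  have hbb : ((G.neighborFinset y).filter fun z => G.dist x z = j + 1).card = bi j := by
    rw [hj, ← h.card_b x y, ncard_setOf_eq_card_filter]
    congr 1
    ext z
    simp
  rw [Finset.sum_congr rfl hpt, Finset.sum_add_distrib, Finset.sum_add_distrib,
    ← Finset.sum_filter, ← Finset.sum_filter, Finset.sum_const, Finset.sum_const,
    Finset.sum_const, hc, hbb, h.card_neighborFinset]
  simp only [nsmul_eq_mul, tridiag]
  ring

theorem IsDistanceRegular.distMatrix_mul_adjMatrix (h : IsDistanceRegular G D bi ci)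
    (f : ℕ → ℝ) : distMatrix G f * G.adjMatrix ℝ = distMatrix G (tridiag bi ci f) := by
  ext x y
  rw [SimpleGraph.mul_adjMatrix_apply]
  exact h.sum_neighborFinset f x y

theorem IsDistanceRegular.adjMatrix_mul_distMatrix (h : IsDistanceRegular G D bi ci)
    {u : ℕ → ℝ} {θ : ℝ} (hu : ∀ j ≤ D, tridiag bi ci u j = θ * u j) :
    G.adjMatrix ℝ * distMatrix G u = θ • distMatrix G u := by
  rw [← Matrix.transpose_inj, Matrix.transpose_mul, Matrix.transpose_smul,
    distMatrix_transpose, SimpleGraph.transpose_adjMatrix, h.distMatrix_mul_adjMatrix]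
  ext x y
  simp [distMatrix, hu _ (h.dist_le x y)]

theorem IsDistanceRegular.distMatrix_congr (h : IsDistanceRegular G D bi ci) {f g : ℕ → ℝ}
    (hfg : ∀ j ≤ D, f j = g j) : distMatrix G f = distMatrix G g := by
  ext x y
  exact hfg _ (h.dist_le x y)

/-- Every function of the distance acts as a scalar on an eigenmatrix of the adjacency matrix. -/
theorem IsDistanceRegular.exists_distMatrix_mul_eq_smul (h : IsDistanceRegular G D bi ci)
    {X : Matrix V V ℝ} {θ : ℝ} (hX : G.adjMatrix ℝ * X = θ • X) (f : ℕ → ℝ) :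
    ∃ c : ℝ, distMatrix G f * X = c • X := by
  have key : ∀ n ≤ D, ∀ f : ℕ → ℝ, (∀ j, n < j → f j = 0) →
      ∃ c : ℝ, distMatrix G f * X = c • X := by
    intro n
    induction n with
    | zero =>
      intro _ f hf
      refine ⟨f 0, ?_⟩
      have : distMatrix G f = f 0 • (1 : Matrix V V ℝ) := by
        ext x y
        by_cases hxy : x = y
        · simp [hxy, distMatrix]
        · simp [hxy, distMatrix, hf _ (h.connected.pos_dist_of_ne hxy)]
      rw [this, Matrix.smul_mul, Matrix.one_mul]
    | succ n ih =>
      intro hn f hf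
      have hc : (ci (n + 1) : ℝ) ≠ 0 := by
        exact_mod_cast (h.ci_pos (Nat.succ_pos n) hn).ne'
      -- Chosen so that `tridiag bi ci g` agrees with f at n + 1; subtracting it lowers the support
      -- bound to n, and the removed part is a multiple of A, which acts on X by θ.
      set g : ℕ → ℝ := fun j => if j = n then f (n + 1) / ci (n + 1) else 0 with hg
      obtain ⟨c₁, h1⟩ := ih (by omega) g (fun j hj => by simp [hg, hj.ne'])
      obtain ⟨c₂, h2⟩ := ih (by omega) (fun j => f j - tridiag bi ci g j) (by
        intro j hj
        rcases Nat.lt_or_ge (n + 1) j with hj' | hj'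
        · simp [hf j hj', tridiag, hg, show j - 1 ≠ n by omega, show j ≠ n by omega,
            show j + 1 ≠ n by omega]
        · obtain rfl : j = n + 1 := by omega
          simp [tridiag, hg, mul_div_cancel₀ _ hc, show n + 1 + 1 ≠ n by omega])
      refine ⟨c₂ + θ * c₁, ?_⟩
      have hsplit : distMatrix G f = distMatrix G (fun j => f j - tridiag bi ci g j) +
          distMatrix G g * G.adjMatrix ℝ := by
        rw [h.distMatrix_mul_adjMatrix]
        ext x y
        simp [distMatrix]
      rw [hsplit, Matrix.add_mul, h2, Matrix.mul_assoc, hX, Matrix.mul_smul, h1, smul_smul,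
        add_smul]
  obtain ⟨c, hc⟩ := key D le_rfl (fun j => if j ≤ D then f j else 0)
    (fun j hj => by simp [hj])
  refine ⟨c, ?_⟩
  rw [← hc, h.distMatrix_congr (f := f) (g := fun j => if j ≤ D then f j else 0)]
  intro j hj
  simp [hj]

/-- The matrix of an eigenfunction is an eigenmatrix of A, so it is multiplied by a scalar under its
own action: up to scaling it is a projection. A diagonal entry of the square, a sum of squares
including u 0 = 1, shows that the scalar is positive. -/
theorem IsDistanceRegular.exists_distMatrix_mul_self (h : IsDistanceRegular G D bi ci)
    {u : ℕ → ℝ} {θ : ℝ} (hu : ∀ j ≤ D, tridiag bi ci u j = θ * u j) (hu0 : u 0 = 1) :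
    ∃ c : ℝ, 0 < c ∧ distMatrix G u * distMatrix G u = c • distMatrix G u := by
  obtain ⟨c, hc⟩ := h.exists_distMatrix_mul_eq_smul (h.adjMatrix_mul_distMatrix hu) u
  refine ⟨c, ?_, hc⟩
  obtain ⟨x⟩ := h.connected.nonempty
  have h1 := congrFun (congrFun hc x) x
  simp only [Matrix.mul_apply, distMatrix, Matrix.of_apply, Matrix.smul_apply,
    SimpleGraph.dist_self, hu0, smul_eq_mul, mul_one] at h1
  rw [← h1]
  refine Finset.sum_pos' (fun z _ => ?_) ⟨x, Finset.mem_univ _, by simp [hu0]⟩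
  rw [SimpleGraph.dist_comm (u := z)]
  exact mul_self_nonneg _

/-- The number of vertices at a given distance from a vertex does not depend on the vertex. -/
theorem IsDistanceRegular.exists_card_sphere (h : IsDistanceRegular G D bi ci) (i : ℕ) :
    ∃ n : ℕ, ∀ x : V, (Finset.univ.filter fun y => G.dist x y = i).card = n := by
  -- The constant function yields the all-ones matrix, on which the sphere matrix acts by its row
  -- sums; these are therefore constant.
  have h1 : ∀ j ≤ D, tridiag bi ci (fun _ => 1) j = (bi 0 : ℝ) * 1 := by
    intro j _
    simp [tridiag]
  obtain ⟨c, hc⟩ := h.exists_distMatrix_mul_eq_smul (h.adjMatrix_mul_distMatrix h1)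
    (fun j => if j = i then 1 else 0)
  have h2 : ∀ x : V, ((Finset.univ.filter fun y => G.dist x y = i).card : ℝ) = c := by
    intro x
    have := congrFun (congrFun hc x) x
    simpa [Matrix.mul_apply, distMatrix] using this
  obtain ⟨x⟩ := h.connected.nonempty
  refine ⟨(Finset.univ.filter fun z => G.dist x z = i).card, fun y => ?_⟩
  exact_mod_cast (h2 y).trans (h2 x).symm

/-- With M the matrix of u and χ the indicator vector of C, this is ‖Mχ‖² = χᵀM²χ = c χᵀMχ.
Nonnegativity gives the clique bound, and vanishing gives Mχ = 0. -/
theorem IsDistanceRegular.exists_sum_sq_clique (h : IsDistanceRegular G D bi ci)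
    {u : ℕ → ℝ} {θ : ℝ} (hu : ∀ j ≤ D, tridiag bi ci u j = θ * u j) (hu0 : u 0 = 1) :
    ∃ c : ℝ, 0 < c ∧ ∀ C : Finset V, G.IsClique (C : Set V) →
      ∑ z, (∑ x ∈ C, u (G.dist x z)) ^ 2 =
        c * (C.card * (1 + ((C.card : ℝ) - 1) * u 1)) := by
  obtain ⟨c, hc, hM⟩ := h.exists_distMatrix_mul_self hu hu0
  refine ⟨c, hc, fun C hC => ?_⟩
  have hM' : ∀ x y, ∑ z, u (G.dist x z) * u (G.dist y z) = c * u (G.dist x y) := by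
    intro x y
    have := congrFun (congrFun hM x) y
    simpa [Matrix.mul_apply, distMatrix, SimpleGraph.dist_comm (u := y)] using this
  simp_rw [← sum_sum_clique hC hu0, sq, Finset.sum_mul_sum, Finset.mul_sum]
  rw [Finset.sum_comm]
  refine Finset.sum_congr rfl fun x _ => ?_
  rw [Finset.sum_comm]
  exact Finset.sum_congr rfl fun y _ => hM' x y

/-- The Delsarte bound for cliques. -/
theorem IsDistanceRegular.clique_bound (h : IsDistanceRegular G D bi ci)
    {u : ℕ → ℝ} {θ : ℝ} (hu : ∀ j ≤ D, tridiag bi ci u j = θ * u j) (hu0 : u 0 = 1)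
    {C : Finset V} (hC : G.IsClique (C : Set V)) (hne : C.Nonempty) :
    0 ≤ 1 + ((C.card : ℝ) - 1) * u 1 := by
  obtain ⟨c, hc, hsum⟩ := h.exists_sum_sq_clique hu hu0
  have h1 : 0 ≤ c * (C.card * (1 + ((C.card : ℝ) - 1) * u 1)) := by
    rw [← hsum C hC]
    positivity
  have h2 : (0 : ℝ) < C.card := by exact_mod_cast hne.card_pos
  exact nonneg_of_mul_nonneg_right (nonneg_of_mul_nonneg_right h1 hc) h2

theorem IsDistanceRegular.sum_eq_zero_of_clique (h : IsDistanceRegular G D bi ci)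
    {u : ℕ → ℝ} {θ : ℝ} (hu : ∀ j ≤ D, tridiag bi ci u j = θ * u j) (hu0 : u 0 = 1)
    {C : Finset V} (hC : G.IsClique (C : Set V))
    (heq : 1 + ((C.card : ℝ) - 1) * u 1 = 0) (z : V) :
    ∑ x ∈ C, u (G.dist x z) = 0 := by
  obtain ⟨c, hc, hsum⟩ := h.exists_sum_sq_clique hu hu0
  have h1 := hsum C hC
  rw [heq, mul_zero, mul_zero, Finset.sum_eq_zero_iff_of_nonneg (fun _ _ => sq_nonneg _)] at h1
  exact pow_eq_zero_iff two_ne_zero |>.1 (h1 z (Finset.mem_univ z))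

/-- An eigenvalue with an alternating eigenfunction is the smallest one. -/
theorem IsDistanceRegular.neg_le_of_eigenvector (h : IsDistanceRegular G D bi ci)
    {w : ℕ → ℝ} {r : ℝ} (hw0 : ∀ j ≤ D, 0 < w j)
    (hw : ∀ j ≤ D, ((bi 0 : ℝ) - bi j - ci j) * w j - ci j * w (j - 1) - bi j * w (j + 1)
      = -r * w j)
    {v : V → ℝ} (hv : v ≠ 0) {θ : ℝ} (hAv : G.adjMatrix ℝ *ᵥ v = θ • v) : -r ≤ θ := by
  obtain ⟨x, hx⟩ := Function.ne_iff.1 hv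
  -- Sums of v over the spheres about x, where v x ≠ 0. They reduce the eigenvalue equation to the
  -- tridiagonal operator.
  set F : ℕ → ℝ := fun i => ∑ z, if G.dist x z = i then v z else 0 with hF
  have hF0 : F 0 = v x := by
    simp [hF, h.connected.dist_eq_zero_iff]
  have hlin : ∀ f : ℕ → ℝ, ∑ z, f (G.dist x z) * v z =
      ∑ i ∈ Finset.range (D + 1), f i * F i := by
    intro f
    simp_rw [hF, Finset.mul_sum]
    rw [Finset.sum_comm]
    refine Finset.sum_congr rfl fun z _ => ?_
    have := h.dist_le x z
    simp [show G.dist x z < D + 1 by omega]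
  have hT : ∀ f : ℕ → ℝ, ∑ i ∈ Finset.range (D + 1), tridiag bi ci f i * F i =
      θ * ∑ i ∈ Finset.range (D + 1), f i * F i := by
    intro f
    rw [← hlin, ← hlin]
    have h1 : distMatrix G (tridiag bi ci f) *ᵥ v = θ • (distMatrix G f *ᵥ v) := by
      rw [← h.distMatrix_mul_adjMatrix, ← Matrix.mulVec_mulVec, hAv, Matrix.mulVec_smul]
    have := congrFun h1 x
    simpa [Matrix.mulVec, dotProduct, distMatrix] using this
  have hsg : ∀ i, (SignType.sign (F i) : ℝ) * F i = |F i| := fun i => by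
    exact sign_mul_self (F i)
  have habs : ∀ i, |(SignType.sign (F i) : ℝ)| ≤ 1 := fun i => by
    rcases lt_trichotomy (F i) 0 with h | h | h <;> simp [h]
  -- Testing against sign(F i) w i makes the right side θ ∑ w i |F i|; the left side is bounded
  -- below termwise by taking the worst sign for the off-diagonal entries.
  have h1 := hT (fun i => SignType.sign (F i) * w i)
  have hle : ∑ i ∈ Finset.range (D + 1), -r * (w i * |F i|) ≤
      ∑ i ∈ Finset.range (D + 1), tridiag bi ci (fun i => SignType.sign (F i) * w i) i * F i := by
    refine Finset.sum_le_sum fun i hi => ?_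
    have hi' : i ≤ D := by simpa [Nat.lt_succ_iff] using hi
    have hwi := hw i hi'
    have hs : ∀ j, 0 ≤ w j → -(w j * |F i|) ≤ SignType.sign (F j) * w j * F i := by
      intro j hj
      have : |(SignType.sign (F j) : ℝ) * w j * F i| ≤ w j * |F i| := by
        rw [abs_mul, abs_mul, abs_of_nonneg hj]
        have := mul_le_mul_of_nonneg_right (habs j) (mul_nonneg hj (abs_nonneg (F i)))
        linarith
      exact (abs_le.1 this).1
    have hc := mul_le_mul_of_nonneg_left (hs (i - 1) (hw0 _ (by omega)).le)
      (Nat.cast_nonneg (α := ℝ) (ci i))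
    have hb : (bi i : ℝ) * -(w (i + 1) * |F i|) ≤
        bi i * (SignType.sign (F (i + 1)) * w (i + 1) * F i) := by
      -- At i = D nothing is known about w (D + 1), but its coefficient b_D vanishes.
      rcases hi'.lt_or_eq with hlt | rfl
      · exact mul_le_mul_of_nonneg_left (hs (i + 1) (hw0 _ hlt).le) (Nat.cast_nonneg _)
      · simp [h.bi_diam]
    have e1 : -r * (w i * |F i|) = (-r * w i) * |F i| := by ring
    rw [e1, ← hwi]
    simp only [tridiag]
    have e2 : SignType.sign (F i) * w i * F i = w i * |F i| := by rw [← hsg i]; ring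
    have e3 := congrArg (fun t => ((bi 0 : ℝ) - bi i - ci i) * t) e2
    beta_reduce at e3
    nlinarith
  have e : ∑ i ∈ Finset.range (D + 1), SignType.sign (F i) * w i * F i =
      ∑ i ∈ Finset.range (D + 1), w i * |F i| :=
    Finset.sum_congr rfl fun i _ => by rw [← hsg i]; ring
  rw [h1, ← Finset.mul_sum, e] at hle
  refine le_of_mul_le_mul_right hle ?_
  refine Finset.sum_pos' (fun i hi => ?_) ⟨0, by simp, ?_⟩
  · have hi' : i ≤ D := by simpa [Nat.lt_succ_iff] using hi
    exact mul_nonneg (hw0 i hi').le (abs_nonneg _)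
  · exact mul_pos (hw0 0 (Nat.zero_le _)) (by rw [hF0]; exact abs_pos.2 hx)

end DistanceRegular

/-! ### Classical parameters -/

section ClassicalParameters

theorem gaussNum_succ (b : ℝ) (j : ℕ) : gaussNum b (j + 1) = gaussNum b j + b ^ j := by
  simp [gaussNum, Finset.sum_range_succ]

@[simp] theorem gaussNum_zero (b : ℝ) : gaussNum b 0 = 0 := by simp [gaussNum]

@[simp] theorem gaussNum_one (b : ℝ) : gaussNum b 1 = 1 := by simp [gaussNum]

theorem gaussNum_two (b : ℝ) : gaussNum b 2 = 1 + b := by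
  simp [gaussNum, Finset.sum_range_succ]

theorem gaussNum_strictMono {b : ℝ} (hb : 0 < b) : StrictMono (gaussNum b) :=
  strictMono_nat_of_lt_succ fun j => by
    rw [gaussNum_succ]
    have := pow_pos hb j
    linarith

/-- The absolute values of the standard sequence of the smallest eigenvalue of a graph with
classical parameters. -/
noncomputable def cosAbs (b α β : ℝ) (j : ℕ) : ℝ :=
  ∏ i ∈ Finset.range j, (1 + α * gaussNum b i) / (β - α * gaussNum b i)

/-- The standard sequence of the smallest eigenvalue of a graph with classical parameters. -/
noncomputable def cosSeq (b α β : ℝ) (j : ℕ) : ℝ := (-1) ^ j * cosAbs b α β j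

theorem cosAbs_succ (b α β : ℝ) (j : ℕ) : cosAbs b α β (j + 1) =
    cosAbs b α β j * ((1 + α * gaussNum b j) / (β - α * gaussNum b j)) := by
  rw [cosAbs, Finset.prod_range_succ, cosAbs]

@[simp] theorem cosSeq_zero (b α β : ℝ) : cosSeq b α β 0 = 1 := by simp [cosSeq, cosAbs]

theorem cosSeq_one (b α β : ℝ) : cosSeq b α β 1 = -(1 / β) := by simp [cosSeq, cosAbs]

theorem cosSeq_two (b α β : ℝ) : cosSeq b α β 2 = (1 + α) / (β * (β - α)) := by
  simp [cosSeq, cosAbs, Finset.prod_range_succ]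

variable {V : Type*} {G : SimpleGraph V} {bi ci : ℕ → ℕ} {D : ℕ} {b α β : ℝ}

namespace HasClassicalParameters

theorem valency_eq (h : HasClassicalParameters G bi ci D b α β) (hD : 0 < D) :
    (bi 0 : ℝ) = gaussNum b D * β := by
  simpa using h.b_eq 0 hD

variable [Fintype V]

/-- Read off from c_{j+1} > 0; no sign of α is known at this stage. -/
theorem one_add_pos (h : HasClassicalParameters G bi ci D b α β) (hb : 0 < b) {j : ℕ}
    (hj : j < D) : 0 < 1 + α * gaussNum b j := by
  have h1 : (0 : ℝ) < ci (j + 1) := by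
    exact_mod_cast h.distanceRegular.ci_pos (Nat.succ_pos j) hj
  rw [h.c_eq (j + 1) (by omega) hj, Nat.add_sub_cancel] at h1
  have h2 : 0 < gaussNum b (j + 1) := by
    simpa using gaussNum_strictMono hb (Nat.succ_pos j)
  exact pos_of_mul_pos_right h1 h2.le

theorem sub_pos (h : HasClassicalParameters G bi ci D b α β) (hb : 0 < b) {j : ℕ}
    (hj : j < D) : 0 < β - α * gaussNum b j := by
  have h1 : (0 : ℝ) < bi j := by exact_mod_cast h.distanceRegular.bi_pos hj
  rw [h.b_eq _ hj] at h1
  exact pos_of_mul_pos_right h1 (_root_.sub_pos.2 (gaussNum_strictMono hb hj)).le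

theorem beta_pos (h : HasClassicalParameters G bi ci D b α β) (hb : 0 < b) (hD : 0 < D) :
    0 < β := by
  simpa using h.sub_pos hb hD

theorem cosAbs_pos (h : HasClassicalParameters G bi ci D b α β) (hb : 0 < b) :
    ∀ j ≤ D, 0 < cosAbs b α β j := fun j hj =>
  Finset.prod_pos fun i hi => by
    have : i < D := (Finset.mem_range.1 hi).trans_le hj
    exact div_pos (h.one_add_pos hb this) (h.sub_pos hb this)

theorem ci_mul_cosAbs (h : HasClassicalParameters G bi ci D b α β) (hb : 0 < b) {j : ℕ}
    (hj : j ≤ D) : ci j * cosAbs b α β (j - 1) =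
      gaussNum b j * (β - α * gaussNum b (j - 1)) * cosAbs b α β j := by
  cases j with
  | zero => simp [h.distanceRegular.ci_zero]
  | succ i =>
    have := (h.sub_pos hb hj).ne'
    rw [h.c_eq _ (by omega) hj, Nat.add_sub_cancel, cosAbs_succ]
    field_simp

theorem bi_mul_cosAbs (h : HasClassicalParameters G bi ci D b α β) (hb : 0 < b) {j : ℕ}
    (hj : j ≤ D) : bi j * cosAbs b α β (j + 1) =
      (gaussNum b D - gaussNum b j) * (1 + α * gaussNum b j) * cosAbs b α β j := by
  rcases hj.lt_or_eq with hlt | rfl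
  · have := div_self (h.sub_pos hb hlt).ne'
    rw [h.b_eq _ hlt, cosAbs_succ]
    linear_combination (gaussNum b D - gaussNum b j) * (1 + α * gaussNum b j) *
      cosAbs b α β j * this
  · simp [h.distanceRegular.bi_diam]

/-- The ratios defining `cosAbs` turn the c- and b-terms into multiples of w j. Then c_j + [j](β -
α[j-1]) = [j](1 + β) and b_j + ([D] - [j])(1 + α[j]) = ([D] - [j])(1 + β), so the total is [D]β -
[D](1 + β) = -[D]. -/
theorem cosAbs_recurrence (h : HasClassicalParameters G bi ci D b α β) (hb : 0 < b)
    (hD : 0 < D) : ∀ j ≤ D, ((bi 0 : ℝ) - bi j - ci j) * cosAbs b α β j -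
      ci j * cosAbs b α β (j - 1) - bi j * cosAbs b α β (j + 1) =
        -gaussNum b D * cosAbs b α β j := by
  intro j hj
  have hbj : (bi j : ℝ) = (gaussNum b D - gaussNum b j) * (β - α * gaussNum b j) := by
    rcases hj.lt_or_eq with hlt | rfl
    · exact h.b_eq _ hlt
    · simp [h.distanceRegular.bi_diam]
  have hcj : (ci j : ℝ) = gaussNum b j * (1 + α * gaussNum b (j - 1)) := by
    rcases Nat.eq_zero_or_pos j with rfl | h0
    · simp [h.distanceRegular.ci_zero]
    · exact h.c_eq _ h0 hj
  rw [h.ci_mul_cosAbs hb hj, h.bi_mul_cosAbs hb hj, h.valency_eq hD, hbj, hcj]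
  ring

theorem tridiag_cosSeq (h : HasClassicalParameters G bi ci D b α β) (hb : 0 < b)
    (hD : 0 < D) : ∀ j ≤ D, tridiag bi ci (cosSeq b α β) j =
      -gaussNum b D * cosSeq b α β j := by
  intro j hj
  have h1 : ci j * cosSeq b α β (j - 1) = -((-1) ^ j * (ci j * cosAbs b α β (j - 1))) := by
    cases j with
    | zero => simp [h.distanceRegular.ci_zero]
    | succ i =>
      rw [Nat.add_sub_cancel, cosSeq, pow_succ]
      ring
  have h2 : (-1 : ℝ) ^ (j + 1) = -(-1) ^ j := by rw [pow_succ]; ring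
  have h3 := h.cosAbs_recurrence hb hD j hj
  rw [tridiag, h1, cosSeq, cosSeq, h2]
  linear_combination (-1) ^ j * h3

theorem neg_gaussNum_le_of_eigenvector (h : HasClassicalParameters G bi ci D b α β)
    (hb : 0 < b) (hD : 0 < D) {v : V → ℝ} (hv : v ≠ 0) {θ : ℝ}
    (hAv : G.adjMatrix ℝ *ᵥ v = θ • v) : -gaussNum b D ≤ θ :=
  h.distanceRegular.neg_le_of_eigenvector (h.cosAbs_pos hb) (h.cosAbs_recurrence hb hD) hv hAv

theorem minEigenvalue_eq (h : HasClassicalParameters G bi ci D b α β) (hb : 0 < b)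
    (hD : 0 < D) : minEigenvalue G = -gaussNum b D := by
  refine IsLeast.csInf_eq ⟨?_, ?_⟩
  · obtain ⟨x⟩ := h.distanceRegular.connected.nonempty
    refine Module.End.hasEigenvalue_of_hasEigenvector (x := fun y => cosSeq b α β (G.dist y x))
      ⟨Module.End.mem_eigenspace_iff.2 ?_, fun h0 => ?_⟩
    · have := h.distanceRegular.adjMatrix_mul_distMatrix (h.tridiag_cosSeq hb hD)
      ext y
      have := congrFun (congrFun this y) x
      simpa [Matrix.mul_apply, Matrix.mulVec, dotProduct, distMatrix] using this
    · simpa using congrFun h0 x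
  · rintro θ hθ
    obtain ⟨v, hv⟩ := Module.End.HasEigenvalue.exists_hasEigenvector hθ
    exact h.neg_gaussNum_le_of_eigenvector hb hD hv.2 (by simpa using hv.apply_eq_smul)

theorem quadraticForm_nonneg (h : HasClassicalParameters G bi ci D b α β) (hb : 0 < b)
    (hD : 0 < D) (v : V → ℝ) :
    0 ≤ ∑ x, v x * ∑ y ∈ G.neighborFinset x, v y + gaussNum b D * ∑ x, v x ^ 2 := by
  have hH : (G.adjMatrix ℝ + gaussNum b D • (1 : Matrix V V ℝ)).IsHermitian := by
    rw [Matrix.IsHermitian, Matrix.conjTranspose_eq_transpose_of_trivial, Matrix.transpose_add,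
      Matrix.transpose_smul, Matrix.transpose_one, SimpleGraph.transpose_adjMatrix]
  have hpos : (G.adjMatrix ℝ + gaussNum b D • (1 : Matrix V V ℝ)).PosSemidef := by
    rw [hH.posSemidef_iff_eigenvalues_nonneg]
    intro j
    have h1 := hH.mulVec_eigenvectorBasis j
    have hne : (hH.eigenvectorBasis j).ofLp ≠ 0 := by
      intro h0
      exact hH.eigenvectorBasis.toBasis.ne_zero j (by ext i; simpa using congrFun h0 i)
    have h2 := h.neg_gaussNum_le_of_eigenvector hb hD hne
      (θ := hH.eigenvalues j - gaussNum b D) (by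
        rw [Matrix.add_mulVec, Matrix.smul_mulVec, Matrix.one_mulVec] at h1
        rw [sub_smul, ← h1, add_sub_cancel_right])
    simpa using h2
  have := hpos.dotProduct_mulVec_nonneg v
  rw [Matrix.add_mulVec, Matrix.smul_mulVec, Matrix.one_mulVec, dotProduct_add,
    dotProduct_smul] at this
  simpa [dotProduct, SimpleGraph.adjMatrix_mulVec_apply, sq] using this

theorem card_clique_le (h : HasClassicalParameters G bi ci D b α β) (hb : 0 < b)
    (hD : 0 < D) {C : Finset V} (hC : G.IsClique (C : Set V)) (hne : C.Nonempty) :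
    (C.card : ℝ) ≤ 1 + β := by
  have h1 := h.distanceRegular.clique_bound (h.tridiag_cosSeq hb hD) (cosSeq_zero b α β) hC hne
  have hβ := h.beta_pos hb hD
  have h2 : 1 + ((C.card : ℝ) - 1) * cosSeq b α β 1 = (1 + β - C.card) / β := by
    rw [cosSeq_one]
    field_simp
    ring
  rw [h2] at h1
  have := mul_nonneg h1 hβ.le
  rw [div_mul_cancel₀ _ hβ.ne'] at this
  linarith

/-- A vertex outside a Delsarte clique with a neighbour in it has `1 + α` neighbours in it. -/
theorem card_filter_adj_of_card_eq (h : HasClassicalParameters G bi ci D b α β) (hb : 0 < b)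
    (hD : 1 < D) {C : Finset V} (hC : G.IsClique (C : Set V)) (hcard : (C.card : ℝ) = 1 + β)
    {y z : V} (hy : y ∉ C) (hz : z ∈ C) (hyz : G.Adj y z) :
    ((C.filter (G.Adj y)).card : ℝ) = 1 + α := by
  have hβ := h.beta_pos hb (by omega)
  have hβα : 0 < β - α := by simpa using h.sub_pos hb hD
  have h1 := h.distanceRegular.sum_eq_zero_of_clique (h.tridiag_cosSeq hb (by omega))
    (cosSeq_zero b α β) hC (by rw [hcard, cosSeq_one]; field_simp; ring) y
  have h2 : ∀ x ∈ C, cosSeq b α β (G.dist x y) =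
      if G.Adj y x then cosSeq b α β 1 else cosSeq b α β 2 := by
    intro x hx
    split_ifs with hxy
    · rw [SimpleGraph.dist_eq_one_iff_adj.2 hxy.symm]
    · have hne : x ≠ y := fun e => hy (e ▸ hx)
      have h3 := h.distanceRegular.connected.one_lt_dist_of_ne_of_not_adj hne
        (fun e => hxy e.symm)
      have hxz : x ≠ z := fun e => hxy (e ▸ hyz)
      have h4 := h.distanceRegular.connected.dist_triangle (u := x) (v := z) (w := y)
      rw [SimpleGraph.dist_eq_one_iff_adj.2 (hC hx hz hxz),
        SimpleGraph.dist_eq_one_iff_adj.2 hyz.symm] at h4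
      rw [show G.dist x y = 2 by omega]
  have h5 : ((C.filter fun x => ¬ G.Adj y x).card : ℝ) = 1 + β - (C.filter (G.Adj y)).card := by
    rw [← hcard, ← Finset.card_filter_add_card_filter_not (s := C) (G.Adj y)]
    push_cast
    ring
  rw [Finset.sum_congr rfl h2, Finset.sum_ite, Finset.sum_const, Finset.sum_const,
    nsmul_eq_mul, nsmul_eq_mul, h5, cosSeq_one, cosSeq_two] at h1
  field_simp at h1
  -- With m neighbours in C, the vanishing sum reads m(β - α) = (1 + β - m)(1 + α), because every
  -- vertex of C is at distance 1 or 2 from y.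
  have h6 : (1 + β) * (((C.filter (G.Adj y)).card : ℝ) - (1 + α)) = 0 := by linarith
  have := (mul_eq_zero.1 h6).resolve_left (by positivity)
  linarith

end HasClassicalParameters

end ClassicalParameters

/-! ### Partial linear spaces with a given point graph -/

section Lines

variable {V : Type*} {G : SimpleGraph V} {L : Finset (Finset V)}

theorem isClique_of_mem_lines
    (hadj : ∀ x y : V, G.Adj x y ↔ x ≠ y ∧ ∃ l ∈ L, x ∈ l ∧ y ∈ l) {l : Finset V} (hl : l ∈ L) :
    G.IsClique (l : Set V) := fun _ hx _ hy hne => (hadj _ _).2 ⟨hne, l, hl, hx, hy⟩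

variable [Fintype V]

/-- The neighbours of `x` are partitioned by the lines through `x`. -/
theorem sum_neighborFinset_eq_sum_lines
    (hu : ∀ p q : V, p ≠ q → ∀ l ∈ L, ∀ m ∈ L, p ∈ l → q ∈ l → p ∈ m → q ∈ m → l = m)
    (hadj : ∀ x y : V, G.Adj x y ↔ x ≠ y ∧ ∃ l ∈ L, x ∈ l ∧ y ∈ l) (x : V) (f : V → ℝ) :
    ∑ y ∈ G.neighborFinset x, f y = ∑ l ∈ L with x ∈ l, ∑ y ∈ l.erase x, f y := by
  rw [← Finset.sum_biUnion]
  · congr 1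
    ext y
    simp only [SimpleGraph.mem_neighborFinset, hadj, Finset.mem_biUnion, Finset.mem_filter,
      Finset.mem_erase]
    constructor
    · rintro ⟨hne, l, hl, hx, hy⟩
      exact ⟨l, ⟨hl, hx⟩, hne.symm, hy⟩
    · rintro ⟨l, ⟨hl, hx⟩, hne, hy⟩
      exact ⟨hne.symm, l, hl, hx, hy⟩
  · intro l hl m hm hne
    simp only [Finset.coe_filter, Set.mem_ofPred_eq] at hl hm
    refine Finset.disjoint_left.2 fun y hyl hym => hne ?_
    rw [Finset.mem_erase] at hyl hym
    exact hu x y hyl.1.symm l hl.1 m hm.1 hl.2 hyl.2 hm.2 hym.2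

theorem sum_sum_lines (f : V → Finset V → ℝ) :
    ∑ l ∈ L, ∑ x ∈ l, f x l = ∑ x, ∑ l ∈ L with x ∈ l, f x l := by
  simp_rw [Finset.sum_filter]
  rw [Finset.sum_comm]
  simp

/-- The matrix identity `N Nᵀ = A + Δ` for the incidence matrix `N`, the adjacency matrix `A` and
the diagonal matrix `Δ` of the numbers of lines through the points. -/
theorem sum_sq_lines
    (hu : ∀ p q : V, p ≠ q → ∀ l ∈ L, ∀ m ∈ L, p ∈ l → q ∈ l → p ∈ m → q ∈ m → l = m)
    (hadj : ∀ x y : V, G.Adj x y ↔ x ≠ y ∧ ∃ l ∈ L, x ∈ l ∧ y ∈ l) (v : V → ℝ) :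
    ∑ l ∈ L, (∑ x ∈ l, v x) ^ 2 = ∑ x, v x * ∑ y ∈ G.neighborFinset x, v y +
      ∑ x, ((L.filter (x ∈ ·)).card : ℝ) * v x ^ 2 := by
  simp_rw [sq, Finset.sum_mul]
  rw [sum_sum_lines (fun x l => v x * ∑ y ∈ l, v y), ← Finset.sum_add_distrib]
  refine Finset.sum_congr rfl fun x _ => ?_
  rw [sum_neighborFinset_eq_sum_lines hu hadj, Finset.mul_sum, ← nsmul_eq_mul,
    ← Finset.sum_const, ← Finset.sum_add_distrib]
  refine Finset.sum_congr rfl fun l hl => ?_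
  rw [← Finset.add_sum_erase l v (Finset.mem_filter.1 hl).2]
  ring

end Lines

/-! ### Counting lines under classical parameters. -/

section ClassicalLines

variable {V : Type*} [Fintype V] {G : SimpleGraph V} {bi ci : ℕ → ℕ} {D : ℕ} {b α β : ℝ}
  {L : Finset (Finset V)}

/-- In a distance-regular graph, a set of more than half of the vertices contains two vertices at
distance `i`. -/
theorem IsDistanceRegular.exists_mem_mem_dist_eq (h : IsDistanceRegular G D bi ci) {i : ℕ}
    (hi : i ≤ D) {S : Finset V} (hS : Fintype.card V < 2 * S.card) :
    ∃ x ∈ S, ∃ y ∈ S, G.dist x y = i := by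
  by_contra! hno
  obtain ⟨n, hn⟩ := h.exists_card_sphere i
  have hn0 : 0 < n := by
    obtain ⟨x, y, hxy, -⟩ := h.exists_dist_eq hi
    rw [← hn x]
    exact Finset.card_pos.2 ⟨y, by simpa using hxy⟩
  -- If S has no pair at distance i, each of its vertices sends all n of its pairs into the
  -- complement, which can receive at most n per vertex; so |S| ≤ |Sᶜ|.
  have h1 : ∀ x ∈ S, (Sᶜ.bipartiteAbove (fun x y => G.dist x y = i) x).card = n := by
    intro x hx
    rw [← hn x]
    congr 1
    ext y
    simp only [Finset.mem_bipartiteAbove, Finset.mem_compl, Finset.mem_filter, Finset.mem_univ,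
      true_and, and_iff_right_iff_imp]
    exact fun hxy hy => hno x hx y hy hxy
  have h2 : ∀ y ∈ Sᶜ, (S.bipartiteBelow (fun x y => G.dist x y = i) y).card ≤ n := by
    intro y _
    rw [← hn y]
    refine Finset.card_le_card fun x hx => ?_
    rw [Finset.mem_bipartiteBelow] at hx
    simpa [SimpleGraph.dist_comm] using hx.2
  have h3 := Finset.sum_card_bipartiteAbove_eq_sum_card_bipartiteBelow (s := S) (t := Sᶜ)
    (fun x y => G.dist x y = i)
  rw [Finset.sum_congr rfl h1, Finset.sum_const, smul_eq_mul] at h3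
  have h4 := Finset.sum_le_card_nsmul _ _ _ h2
  rw [← h3, smul_eq_mul, Finset.card_compl] at h4
  have := Nat.le_of_mul_le_mul_right h4 hn0
  omega

theorem IsDistanceRegular.valency_eq_sum_lines (h : IsDistanceRegular G D bi ci)
    (hu : ∀ p q : V, p ≠ q → ∀ l ∈ L, ∀ m ∈ L, p ∈ l → q ∈ l → p ∈ m → q ∈ m → l = m)
    (hadj : ∀ x y : V, G.Adj x y ↔ x ≠ y ∧ ∃ l ∈ L, x ∈ l ∧ y ∈ l) (x : V) :
    (bi 0 : ℝ) = ∑ l ∈ L with x ∈ l, ((l.card : ℝ) - 1) := by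
  have h1 := sum_neighborFinset_eq_sum_lines hu hadj x (fun _ => 1)
  rw [Finset.sum_const, h.card_neighborFinset, nsmul_eq_mul, mul_one] at h1
  rw [h1]
  refine Finset.sum_congr rfl fun l hl => ?_
  have hx := (Finset.mem_filter.1 hl).2
  rw [Finset.sum_const, Finset.card_erase_of_mem hx, nsmul_eq_mul, mul_one,
    Nat.cast_sub (Finset.card_pos.2 ⟨x, hx⟩), Nat.cast_one]

namespace HasClassicalParameters

theorem card_line_sub_one_le (h : HasClassicalParameters G bi ci D b α β) (hb : 0 < b)
    (hD : 0 < D) (hadj : ∀ x y : V, G.Adj x y ↔ x ≠ y ∧ ∃ l ∈ L, x ∈ l ∧ y ∈ l) (x : V) :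
    ∀ l ∈ L.filter (x ∈ ·), (l.card : ℝ) - 1 ≤ β := by
  intro l hl
  rw [Finset.mem_filter] at hl
  linarith [h.card_clique_le hb hD (isClique_of_mem_lines hadj hl.1) ⟨x, hl.2⟩]

theorem gaussNum_le_card_lines (h : HasClassicalParameters G bi ci D b α β) (hb : 0 < b)
    (hD : 0 < D)
    (hu : ∀ p q : V, p ≠ q → ∀ l ∈ L, ∀ m ∈ L, p ∈ l → q ∈ l → p ∈ m → q ∈ m → l = m)
    (hadj : ∀ x y : V, G.Adj x y ↔ x ≠ y ∧ ∃ l ∈ L, x ∈ l ∧ y ∈ l) (x : V) :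
    gaussNum b D ≤ (L.filter (x ∈ ·)).card := by
  have h1 := h.distanceRegular.valency_eq_sum_lines hu hadj x
  have h2 := Finset.sum_le_card_nsmul _ _ _ (h.card_line_sub_one_le hb hD hadj x)
  rw [← h1, h.valency_eq hD, nsmul_eq_mul] at h2
  exact le_of_mul_le_mul_right h2 (h.beta_pos hb hD)

theorem card_line_eq (h : HasClassicalParameters G bi ci D b α β) (hb : 0 < b)
    (hD : 0 < D)
    (hu : ∀ p q : V, p ≠ q → ∀ l ∈ L, ∀ m ∈ L, p ∈ l → q ∈ l → p ∈ m → q ∈ m → l = m)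
    (hadj : ∀ x y : V, G.Adj x y ↔ x ≠ y ∧ ∃ l ∈ L, x ∈ l ∧ y ∈ l) {x : V}
    (hx : gaussNum b D = (L.filter (x ∈ ·)).card) {l : Finset V} (hl : l ∈ L) (hxl : x ∈ l) :
    (l.card : ℝ) = 1 + β := by
  have h1 := h.distanceRegular.valency_eq_sum_lines hu hadj x
  have h2 : ∑ l ∈ L with x ∈ l, ((l.card : ℝ) - 1) = ∑ l ∈ L with x ∈ l, β := by
    rw [← h1, h.valency_eq hD, Finset.sum_const, nsmul_eq_mul, hx]
  have h3 := (Finset.sum_eq_sum_iff_of_le (h.card_line_sub_one_le hb hD hadj x)).1 h2 l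
    (Finset.mem_filter.2 ⟨hl, hxl⟩)
  linarith

theorem card_le_card_lines_add (h : HasClassicalParameters G bi ci D b α β) (hb : 0 < b)
    (hD : 0 < D)
    (hu : ∀ p q : V, p ≠ q → ∀ l ∈ L, ∀ m ∈ L, p ∈ l → q ∈ l → p ∈ m → q ∈ m → l = m)
    (hadj : ∀ x y : V, G.Adj x y ↔ x ≠ y ∧ ∃ l ∈ L, x ∈ l ∧ y ∈ l) :
    Fintype.card V ≤
      L.card + (Finset.univ.filter fun x => gaussNum b D = (L.filter (x ∈ ·)).card).card := by
  set S := Finset.univ.filter fun x => gaussNum b D = (L.filter (x ∈ ·)).card with hS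
  -- Records all line sums together with the values on S; injectivity is the claimed dimension
  -- inequality.
  let F : (V → ℝ) →ₗ[ℝ] (L → ℝ) × (S → ℝ) :=
    LinearMap.prod (LinearMap.pi fun l => ∑ x ∈ l.1, LinearMap.proj x)
      (LinearMap.pi fun x => LinearMap.proj x.1)
  have hF : Function.Injective F := by
    rw [← LinearMap.ker_eq_bot, LinearMap.ker_eq_bot']
    intro v hv
    have hL : ∀ l ∈ L, ∑ x ∈ l, v x = 0 := fun l hl => by
      simpa [F] using congrFun (congrArg Prod.fst hv) ⟨l, hl⟩
    have hSv : ∀ x ∈ S, v x = 0 := fun x hx => by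
      simpa [F] using congrFun (congrArg Prod.snd hv) ⟨x, hx⟩
    have h1 := sum_sq_lines hu hadj v
    rw [Finset.sum_eq_zero fun l hl => by rw [hL l hl, sq, mul_zero]] at h1
    have h2 := h.quadraticForm_nonneg hb hD v
    have hterm : ∀ x ∈ Finset.univ,
        0 ≤ (((L.filter (x ∈ ·)).card : ℝ) - gaussNum b D) * v x ^ 2 := fun x _ =>
      mul_nonneg (_root_.sub_nonneg.2 (h.gaussNum_le_card_lines hb hD hu hadj x)) (sq_nonneg _)
    have h3 : ∑ x, (((L.filter (x ∈ ·)).card : ℝ) - gaussNum b D) * v x ^ 2 = 0 := by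
      refine le_antisymm ?_ (Finset.sum_nonneg hterm)
      simp_rw [sub_mul]
      rw [Finset.sum_sub_distrib, ← Finset.mul_sum]
      linarith
    ext x
    by_cases hx : x ∈ S
    · exact hSv x hx
    · have h4 := (Finset.sum_eq_zero_iff_of_nonneg hterm).1 h3 x (Finset.mem_univ x)
      rcases mul_eq_zero.1 h4 with h5 | h5
      · exact absurd (by simp only [hS, Finset.mem_filter, Finset.mem_univ, true_and]; linarith) hx
      · exact pow_eq_zero_iff two_ne_zero |>.1 h5
  simpa using LinearMap.finrank_le_finrank_of_injective hF

/-- If all lines through `x` are Delsarte cliques and `y` is at distance `2` from `x`, then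
exactly `b + 1` lines through `x` contain neighbours of `y`. -/
theorem card_lines_meeting (h : HasClassicalParameters G bi ci D b α β) (hb : 0 < b)
    (hD : 1 < D)
    (hu : ∀ p q : V, p ≠ q → ∀ l ∈ L, ∀ m ∈ L, p ∈ l → q ∈ l → p ∈ m → q ∈ m → l = m)
    (hadj : ∀ x y : V, G.Adj x y ↔ x ≠ y ∧ ∃ l ∈ L, x ∈ l ∧ y ∈ l) {x y : V}
    (hx : ∀ l ∈ L, x ∈ l → (l.card : ℝ) = 1 + β) (hxy : G.dist x y = 2) :
    ((L.filter fun l => x ∈ l ∧ ∃ z ∈ l, G.Adj y z).card : ℝ) = b + 1 := by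
  have hyx : ¬ G.Adj y x := fun e => by
    rw [SimpleGraph.dist_eq_one_iff_adj.2 e.symm] at hxy
    omega
  have hne : y ≠ x := fun e => by simp [e] at hxy
  -- Counts the c₂ common neighbours of x and y line by line; each line through x contributes 1 + α
  -- or nothing.
  have h1 := sum_neighborFinset_eq_sum_lines hu hadj x (fun z => if G.Adj y z then 1 else 0)
  have h2 : ∑ z ∈ G.neighborFinset x, (if G.Adj y z then (1 : ℝ) else 0) = ci 2 := by
    rw [Finset.sum_boole]
    have := h.distanceRegular.card_c x y
    rw [hxy, ncard_setOf_eq_card_filter] at this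
    rw [← this]
    congr 2
    ext z
    simp [← SimpleGraph.dist_eq_one_iff_adj, and_comm]
  have h3 : ∀ l ∈ L.filter (x ∈ ·), ∑ z ∈ l.erase x, (if G.Adj y z then (1 : ℝ) else 0) =
      if ∃ z ∈ l, G.Adj y z then 1 + α else 0 := by
    intro l hl
    rw [Finset.mem_filter] at hl
    rw [Finset.sum_erase _ (by simp [hyx]), Finset.sum_boole]
    split_ifs with hz
    · obtain ⟨z, hz, hyz⟩ := hz
      have hcl := isClique_of_mem_lines hadj hl.1
      refine h.card_filter_adj_of_card_eq hb hD hcl (hx l hl.1 hl.2) (fun hy => ?_) hz hyz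
      exact hyx (hcl hy hl.2 hne)
    · push Not at hz
      rw [Finset.filter_false_of_mem hz]
      simp
  rw [h2, Finset.sum_congr rfl h3, ← Finset.sum_filter, Finset.sum_const, nsmul_eq_mul,
    h.c_eq 2 (by norm_num) hD, gaussNum_two, Finset.filter_filter] at h1
  have hα : 0 < 1 + α := by simpa using h.one_add_pos hb hD
  have h4 := mul_right_cancel₀ (b := 1 + α) hα.ne' (by simpa using h1.symm)
  rw [h4, add_comm]

/-- If all lines through two vertices at distance `2` are Delsarte cliques, then `α ≤ b`. -/
theorem alpha_le (h : HasClassicalParameters G bi ci D b α β) (hb : 0 < b)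
    (hD : 1 < D)
    (hu : ∀ p q : V, p ≠ q → ∀ l ∈ L, ∀ m ∈ L, p ∈ l → q ∈ l → p ∈ m → q ∈ m → l = m)
    (hadj : ∀ x y : V, G.Adj x y ↔ x ≠ y ∧ ∃ l ∈ L, x ∈ l ∧ y ∈ l) {x y : V}
    (hx : ∀ l ∈ L, x ∈ l → (l.card : ℝ) = 1 + β) (hy : ∀ l ∈ L, y ∈ l → (l.card : ℝ) = 1 + β)
    (hxy : G.dist x y = 2) : α ≤ b := by
  have h1 := h.card_lines_meeting hb hD hu hadj hx hxy
  have h2 := h.card_lines_meeting hb hD hu hadj hy (by rwa [SimpleGraph.dist_comm])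
  have hyx : ¬ G.Adj y x := fun e => by
    rw [SimpleGraph.dist_eq_one_iff_adj.2 e.symm] at hxy
    omega
  have hne : y ≠ x := fun e => by simp [e] at hxy
  obtain ⟨l, hl⟩ : (L.filter fun l => x ∈ l ∧ ∃ z ∈ l, G.Adj y z).Nonempty := by
    rw [← Finset.card_pos, ← Nat.cast_pos (α := ℝ), h1]
    linarith
  simp only [Finset.mem_filter] at hl
  obtain ⟨hl, hxl, z, hz, hyz⟩ := hl
  have hcl := isClique_of_mem_lines hadj hl
  have hyl : y ∉ l := fun e => hyx (hcl e hxl hne)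
  have h3 := h.card_filter_adj_of_card_eq hb hD hcl (hx l hl hxl) hyl hz hyz
  have hex : ∀ w : V, ∃ m : Finset V, G.Adj y w → m ∈ L ∧ y ∈ m ∧ w ∈ m := by
    intro w
    by_cases hw : G.Adj y w
    · obtain ⟨-, m, hm⟩ := (hadj y w).1 hw
      exact ⟨m, fun _ => hm⟩
    · exact ⟨∅, fun e => absurd e hw⟩
  choose φ hφ using hex
  have h4 : (l.filter (G.Adj y)).card ≤
      -- The 1 + α neighbours of y on l are joined to y by distinct lines, since a line through two
      -- of them would be l, which misses y. Each such line is among the b + 1 lines through y that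
      -- contain a neighbour of x.
      (L.filter fun m => y ∈ m ∧ ∃ w ∈ m, G.Adj x w).card := by
    refine Finset.card_le_card_of_injOn φ (fun w hw => ?_) (fun w hw w' hw' he => ?_)
    · rw [Finset.mem_coe, Finset.mem_filter] at hw
      obtain ⟨hm, hym, hwm⟩ := hφ w hw.2
      rw [Finset.mem_coe, Finset.mem_filter]
      exact ⟨hm, hym, w, hwm, hcl hxl hw.1 fun e => hyx (e ▸ hw.2)⟩
    · rw [Finset.mem_coe, Finset.mem_filter] at hw hw'
      by_contra hww
      obtain ⟨hm, hym, hwm⟩ := hφ w hw.2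
      have hwm' := (hφ w' hw'.2).2.2
      rw [← he] at hwm'
      exact hyl (hu w w' hww l hl _ hm hw.1 hw'.1 hwm hwm' ▸ hym)
  have h5 : ((l.filter (G.Adj y)).card : ℝ) ≤
      (L.filter fun m => y ∈ m ∧ ∃ w ∈ m, G.Adj x w).card := by exact_mod_cast h4
  linarith

theorem isDelsarteClique_iff (h : HasClassicalParameters G bi ci D b α β) (hb : 0 < b)
    (hD : 0 < D) (C : Set V) :
    IsDelsarteClique G (bi 0) C ↔ G.IsClique C ∧ (C.ncard : ℝ) = 1 + β := by
  have hr : gaussNum b D ≠ 0 := by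
    simpa using (gaussNum_strictMono hb hD).ne'
  rw [IsDelsarteClique, h.minEigenvalue_eq hb hD, neg_neg, h.valency_eq hD,
    mul_div_cancel_left₀ _ hr]

/-- Here c₂ = (1 + b)(1 + α) = b + (1 + α[2]), and the bracket is positive because D ≥ 3. -/
theorem two_lt_c_two (h : HasClassicalParameters G bi ci D b α β) (hb : 2 ≤ b) (hD : 3 ≤ D) :
    (2 : ℝ) < ci 2 := by
  have h1 := h.one_add_pos (j := 2) (by linarith) hD
  rw [gaussNum_two] at h1
  rw [h.c_eq 2 (by norm_num) (by omega), gaussNum_two, Nat.add_sub_cancel_left 1 1, gaussNum_one]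
  linarith

end HasClassicalParameters

end ClassicalLines

end ClassicalDRG

/-! ### The main theorem. -/

open scoped Classical in
theorem proposition13 {V : Type*} [Fintype V] (G : SimpleGraph V) (bi ci : ℕ → ℕ)
    (D : ℕ) (b α β : ℝ)
    (hG : ClassicalDRG.HasClassicalParameters G bi ci D b α β)
    (hb : 2 ≤ b) (hD : 3 ≤ D) (s : ℕ) (hs : 0 < s)
    (hS : ClassicalDRG.HasSPLS G bi ci s) :
    ClassicalDRG.gaussNum b D ≤ (s : ℝ) ∧
    ((ci 2 : ℝ) - 2) / ((ci 2 : ℝ) - 1) * (Fintype.card V : ℝ) <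
      ({x : V | ClassicalDRG.IsDelsarteVertex G (bi 0)
        (ClassicalDRG.splsLines G bi ci (ci 2) s) x}.ncard : ℝ) ∧
    (∃ n : ℤ, (n : ℝ) = α ∧ 0 ≤ α ∧ α ≤ b) ∧
    (∃ m : ℕ, 0 < m ∧ (m : ℝ) = β) ∧
    (∃ x y : V, G.dist x y = 2 ∧
      b + 1 ≤ ((ClassicalDRG.lineInterval G
        (ClassicalDRG.splsLines G bi ci (ci 2) s) x y).ncard : ℝ)) := by
  have hb0 : 0 < b := by linarith
  have hD0 : 0 < D := by omega
  have hD1 : 1 < D := by omega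
  have hdr := hG.distanceRegular
  have hc2 := hG.two_lt_c_two hb hD
  have hβ := hG.beta_pos hb0 hD0
  set 𝓢 := ClassicalDRG.splsLines G bi ci (ci 2) s
  set L : Finset (Finset V) := Finset.univ.filter fun C => (C : Set V) ∈ 𝓢 with hLdef
  have hL : ∀ {C : Finset V}, C ∈ L ↔ (C : Set V) ∈ 𝓢 := by simp [hLdef]
  have hsurj : ∀ l : Set V, ∃ C : Finset V, (C : Set V) = l := fun l => ⟨l.toFinset, by simp⟩
  have hncard : ∀ P : Set V → Prop,
      {l | l ∈ 𝓢 ∧ P l}.ncard = (L.filter fun C : Finset V => P (C : Set V)).card := by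
    intro P
    rw [← Set.ncard_coe_finset, ← Set.ncard_image_of_injective _ Finset.coe_injective]
    congr 1
    ext l
    obtain ⟨C, rfl⟩ := hsurj l
    simp [hL]
  have hu : ∀ p q : V, p ≠ q → ∀ l ∈ L, ∀ m ∈ L, p ∈ l → q ∈ l → p ∈ m → q ∈ m → l = m := by
    intro p q hpq l hl m hm h1 h2 h3 h4
    exact Finset.coe_injective
      (hS.partialLinearSpace.line_unique p q hpq l (hL.1 hl) m (hL.1 hm) h1 h2 h3 h4)
  have hadj : ∀ x y : V, G.Adj x y ↔ x ≠ y ∧ ∃ l ∈ L, x ∈ l ∧ y ∈ l := by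
    intro x y
    rw [hS.pointGraph x y]
    refine and_congr_right fun _ => ⟨?_, ?_⟩
    · rintro ⟨l, hl, hx, hy⟩
      obtain ⟨C, rfl⟩ := hsurj l
      exact ⟨C, hL.2 hl, hx, hy⟩
    · rintro ⟨l, hl, hx, hy⟩
      exact ⟨l, hL.1 hl, hx, hy⟩
  have hm : ∀ x, (L.filter (x ∈ ·)).card ≤ s := by
    intro x
    have := hS.lines_le x
    rw [hncard (x ∈ ·)] at this
    simpa using this
  -- From a₁ + 2 - (c₂ - 1)(s - 1) and a₁ ≥ (2s - 1)(c₂ - 1). The extra 2 makes the bound on the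
  -- number of lines strict.
  have hcardL : ∀ l ∈ L, s * ((ci 2 : ℝ) - 1) + 2 ≤ l.card := by
    intro l hl
    have h1 := (hL.1 hl).2
    rw [Set.ncard_coe_finset] at h1
    have h2 := hS.a_one_ge
    have h3 : (s : ℤ) * ((ci 2 : ℤ) - 1) + 2 ≤ l.card := by linarith
    exact_mod_cast h3
  have hLpos : (0 : ℝ) < L.card := by
    obtain ⟨l, hl⟩ := hS.partialLinearSpace.lines_nonempty
    obtain ⟨C, rfl⟩ := hsurj l
    exact_mod_cast Finset.card_pos.2 ⟨C, hL.2 hl⟩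
  have hsR : (0 : ℝ) < s := by exact_mod_cast hs
  have hLlt : (L.card : ℝ) * ((ci 2 : ℝ) - 1) < Fintype.card V := by
    have h1 : ∑ l ∈ L, (l.card : ℝ) = ∑ x, ((L.filter (x ∈ ·)).card : ℝ) := by
      have := ClassicalDRG.sum_sum_lines (L := L) (fun _ _ => (1 : ℝ))
      simpa using this
    have h2 := Finset.card_nsmul_le_sum _ _ _ hcardL
    have h3 : ∑ x, ((L.filter (x ∈ ·)).card : ℝ) ≤ Fintype.card V * s := by
      have := Finset.sum_le_card_nsmul Finset.univ
        (fun x => ((L.filter (x ∈ ·)).card : ℝ)) s (fun x _ => by exact_mod_cast hm x)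
      simpa using this
    rw [nsmul_eq_mul] at h2
    refine lt_of_mul_lt_mul_right ?_ hsR.le
    linarith
  set S := Finset.univ.filter fun x => ClassicalDRG.gaussNum b D = (L.filter (x ∈ ·)).card
    with hSdef
  have hn := hG.card_le_card_lines_add hb0 hD0 hu hadj
  rw [← hSdef] at hn
  have hnR : (Fintype.card V : ℝ) ≤ L.card + S.card := by exact_mod_cast hn
  have hSline : ∀ x ∈ S, ∀ l ∈ L, x ∈ l → (l.card : ℝ) = 1 + β := fun x hx l hl hxl =>
    hG.card_line_eq hb0 hD0 hu hadj (Finset.mem_filter.1 hx).2 hl hxl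
  have hSD : (S : Set V) ⊆ {x : V | ClassicalDRG.IsDelsarteVertex G (bi 0) 𝓢 x} := by
    intro x hx l hl hxl
    obtain ⟨C, rfl⟩ := hsurj l
    rw [hG.isDelsarteClique_iff hb0 hD0, Set.ncard_coe_finset]
    exact ⟨ClassicalDRG.isClique_of_mem_lines hadj (hL.2 hl), hSline x hx C (hL.2 hl) hxl⟩
  have hScard : ((ci 2 : ℝ) - 2) / ((ci 2 : ℝ) - 1) * Fintype.card V < S.card := by
    rw [div_mul_eq_mul_div, div_lt_iff₀ (by linarith)]
    nlinarith
  have hhalf : Fintype.card V < 2 * S.card := by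
    have h1 : (3 : ℝ) ≤ ci 2 := by exact_mod_cast hc2
    have h2 : (L.card : ℝ) * 2 ≤ L.card * ((ci 2 : ℝ) - 1) :=
      mul_le_mul_of_nonneg_left (by linarith) hLpos.le
    have h3 : (Fintype.card V : ℝ) < 2 * S.card := by linarith
    exact_mod_cast h3
  obtain ⟨x, hx, y, hy, hxy⟩ := hdr.exists_mem_mem_dist_eq (i := 2) (by omega) hhalf
  have hmeet := hG.card_lines_meeting hb0 hD1 hu hadj (hSline x hx) hxy
  obtain ⟨l, hl⟩ : (L.filter fun l => x ∈ l ∧ ∃ z ∈ l, G.Adj y z).Nonempty := by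
    rw [← Finset.card_pos, ← Nat.cast_pos (α := ℝ), hmeet]
    linarith
  simp only [Finset.mem_filter] at hl
  obtain ⟨hl, hxl, z, hz, hyz⟩ := hl
  have hcl := ClassicalDRG.isClique_of_mem_lines hadj hl
  have hyl : y ∉ l := fun e => by
    have := hcl hxl e (fun e => by simp [e] at hxy)
    rw [SimpleGraph.dist_eq_one_iff_adj.2 this] at hxy
    omega
  have hlcard := hSline x hx l hl hxl
  have hτ := hG.card_filter_adj_of_card_eq hb0 hD1 hcl hlcard hyl hz hyz
  have hτ1 : (1 : ℝ) ≤ (l.filter (G.Adj y)).card := by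
    exact_mod_cast Finset.card_pos.2 ⟨z, Finset.mem_filter.2 ⟨hz, hyz⟩⟩
  refine ⟨?_, ?_, ⟨(l.filter (G.Adj y)).card - 1, ?_, by linarith,
    hG.alpha_le hb0 hD1 hu hadj (hSline x hx) (hSline y hy) hxy⟩, ⟨l.card - 1, ?_, ?_⟩,
    x, y, hxy, ?_⟩
  · exact (hG.gaussNum_le_card_lines hb0 hD0 hu hadj x).trans (by exact_mod_cast hm x)
  · refine hScard.trans_le ?_
    rw [← Set.ncard_coe_finset]
    exact_mod_cast Set.ncard_le_ncard hSD
  · push_cast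
    linarith
  · have : (1 : ℝ) < l.card := by linarith
    have : 1 < l.card := by exact_mod_cast this
    omega
  · rw [Nat.cast_sub (Finset.card_pos.2 ⟨x, hxl⟩), hlcard]
    simp
  -- Every point of a clique containing a neighbour of y is within distance 2 of y, so the b + 1
  -- lines already counted all lie in [x, y].
  · rw [← hmeet, ClassicalDRG.lineInterval, hncard fun l => x ∈ l ∧ ∀ u ∈ l, G.dist y u ≤ 2]
    refine Nat.cast_le.2 (Finset.card_le_card fun m hm' => ?_)
    simp only [Finset.mem_filter] at hm' ⊢
    obtain ⟨hm', hxm, w, hw, hyw⟩ := hm'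
    refine ⟨hm', hxm, fun u hum => ?_⟩
    have hyw1 := SimpleGraph.dist_eq_one_iff_adj.2 hyw
    by_cases hwu : w = u
    · rw [← hwu, hyw1]
      norm_num
    · have h1 := hdr.connected.dist_triangle (u := y) (v := w) (w := u)
      rw [hyw1, SimpleGraph.dist_eq_one_iff_adj.2
        (ClassicalDRG.isClique_of_mem_lines hadj hm' hw hum hwu)] at h1
      exact h1
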